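/- A permutation $w=w_1\cdots w_n$ of $\{1,\dots,n\}$ is a Baxter permutation if it avoids the vincular patterns 3-14-2 and 2-41-3; that is, there are no indices $i<j<j+1<k$ with $w_j<w_k<w_i<w_{j+1}$, and none with $w_{j+1}<w_i<w_k<w_j$. Let $n\ge 1$. The number of Baxter permutations of length $n$ whose permutation matrix is fixed under rotation by $90^\circ$ equals $2^m C_m$ if $n=4m+1$ for an integer $m\ge 0$, where $C_m=\frac{1}{m+1}\binom{2m}{m}$ is the $m$-th Catalan number, and equals $0$ if $n$ is not of this form. -/

import Mathlib

/-- An occurrence of the vincular pattern 3-14-2 in `w`: positions `i < j < j + 1 < k` with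
`w j < w k < w i < w (j + 1)`. Here `j'` is the position `j + 1`. -/
def Contains3142 {n : ℕ} (w : Equiv.Perm (Fin n)) : Prop :=
  ∃ i j j' k : Fin n, i < j ∧ (j' : ℕ) = (j : ℕ) + 1 ∧ j' < k ∧
    w j < w k ∧ w k < w i ∧ w i < w j'

/-- An occurrence of the vincular pattern 2-41-3 in `w`: positions `i < j < j + 1 < k` with
`w (j + 1) < w i < w k < w j`. Here `j'` is the position `j + 1`. -/
def Contains2413 {n : ℕ} (w : Equiv.Perm (Fin n)) : Prop :=
  ∃ i j j' k : Fin n, i < j ∧ (j' : ℕ) = (j : ℕ) + 1 ∧ j' < k ∧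
    w j' < w i ∧ w i < w k ∧ w k < w j

/-- Baxter permutations: those avoiding 3-14-2 and 2-41-3. -/
def IsBaxter {n : ℕ} (w : Equiv.Perm (Fin n)) : Prop :=
  ¬ Contains3142 w ∧ ¬ Contains2413 w

/-- Clockwise rotation of a square matrix by 90 degrees: the first row of the result is the first
column of `M` read from bottom to top. -/
def rotate90 {n : ℕ} {R : Type*} (M : Matrix (Fin n) (Fin n) R) : Matrix (Fin n) (Fin n) R :=
  Matrix.of fun i j => M j.rev i

/-- The Baxter permutations of length `n` whose permutation matrix is fixed under rotation by
90 degrees. -/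
def quarterTurnBaxter (n : ℕ) : Set (Equiv.Perm (Fin n)) :=
  {w | IsBaxter w ∧ rotate90 (w.permMatrix ℤ) = w.permMatrix ℤ}

/-!
A quarter-turn symmetric permutation of length at least 4 has a 4-cycle of boundary points, running
through its first entry, its largest entry, its last entry and its smallest entry. Deleting it
leaves a symmetric permutation of length shorter by 4. Containing 3-14-2 is equivalent to containing
a mesh pattern that is invariant under quarter turns, so an occurrence which uses boundary points
can be pushed into the core one point at a time, and the Baxter property passes between the
permutation and its core. Up to the mirror symmetry, which accounts for a factor 2 at each stage,
the largest entry can be put back exactly in front of a left-to-right maximum; if `l` left-to-right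
maxima precede that one, the result has `l + 2` of them. This is the Catalan generating tree, in
which a node labelled `k` has children labelled `2, …, k + 1`. A length not divisible by 4 leaves a
core of length 1, 2 or 3, and only length 1 admits a symmetric permutation; length 4 does not
arise from the empty core, which has no left-to-right maximum.
-/

/-- The number of nodes at depth `d` below a node labelled `k` in the generating tree in which a
node labelled `k` has children labelled `2, …, k + 1`. -/
def treeCount : ℕ → ℕ → ℕ
  | 0, _ => 1
  | d + 1, k => ∑ l ∈ Finset.range k, treeCount d (l + 2)

-- The ballot numbers, with both sides moved so that no subtraction occurs.
theorem treeCount_succ_add_choose (d k : ℕ) :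
    treeCount (d + 1) k + (2 * d + 1 + k).choose d = (2 * d + 1 + k).choose (d + 1) := by
  induction d generalizing k with
  | zero => simp [treeCount, add_comm]
  | succ d ihd =>
    induction k with
    | zero => simpa [treeCount] using (Nat.choose_symm_half (d + 1)).symm
    | succ k ihk =>
      have h_step : treeCount (d + 1 + 1) (k + 1) =
          treeCount (d + 1 + 1) k + treeCount (d + 1) (k + 2) := Finset.sum_range_succ _ _
      have h_prev := ihd (k + 2)
      rw [show 2 * d + 1 + (k + 2) = 2 * (d + 1) + 1 + k by ring] at h_prev
      rw [h_step, ← add_assoc _ k 1, Nat.choose_succ_succ' _ d, Nat.choose_succ_succ' _ (d + 1)]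
      lia

theorem treeCount_one (d : ℕ) : treeCount d 1 = catalan d := by
  cases d with
  | zero => simp [treeCount]
  | succ d =>
    have h_ballot := treeCount_succ_add_choose d 1
    have h_catalan : (d + 2) * catalan (d + 1) = (2 * d + 2).choose (d + 1) := by
      simpa [Nat.centralBinom_eq_two_mul_choose, mul_add] using
        succ_mul_catalan_eq_centralBinom (d + 1)
    have h_choose : (2 * d + 2).choose (d + 1) * (d + 1) = (2 * d + 2).choose d * (d + 2) := by
      rw [Nat.choose_succ_right_eq, show 2 * d + 2 - d = d + 2 by omega]
    refine Nat.eq_of_mul_eq_mul_left (Nat.succ_pos (d + 1)) ?_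
    nlinarith

theorem sum_card_filter_lt {α M : Type*} [LinearOrder α] [AddCommMonoid M] (A : Finset α)
    (g : ℕ → M) : ∑ q ∈ A, g (A.filter (· < q)).card = ∑ l ∈ Finset.range A.card, g l := by
  induction A using Finset.induction_on_max with
  | empty => simp
  | insert a A ha ih =>
    have h_notMem : a ∉ A := fun h => (ha a h).false
    rw [Finset.sum_insert h_notMem, Finset.card_insert_of_notMem h_notMem, Finset.sum_range_succ,
      ← ih, add_comm]
    congr 1
    · refine Finset.sum_congr rfl fun q hq => ?_
      rw [Finset.filter_insert, if_neg (ha q hq).not_gt]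
    · rw [Finset.filter_insert, if_neg (lt_irrefl a), Finset.filter_true_of_mem ha]

/-- Quarter-turn symmetry of the permutation matrix: the square of `w` is the reversal. -/
def IsQuarterTurn {n : ℕ} (w : Equiv.Perm (Fin n)) : Prop :=
  ∀ x, w (w x) = x.rev

theorem rotate90_permMatrix_eq_iff {n : ℕ} (w : Equiv.Perm (Fin n)) :
    rotate90 (w.permMatrix ℤ) = w.permMatrix ℤ ↔ IsQuarterTurn w := by
  have h_entries : rotate90 (w.permMatrix ℤ) = w.permMatrix ℤ ↔
      ∀ i j, w j.rev = i ↔ w i = j := by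
    rw [← Matrix.ext_iff]
    refine forall₂_congr fun i j => ?_
    simp only [rotate90, Matrix.of_apply, Equiv.Perm.permMatrix, PEquiv.toMatrix_apply,
      Equiv.toPEquiv_apply, Option.mem_def, Option.some.injEq]
    by_cases h1 : w j.rev = i <;> by_cases h2 : w i = j <;> simp [h1, h2]
  rw [h_entries]
  constructor
  · intro h x
    exact (h (w x) x.rev).1 (by rw [Fin.rev_rev])
  · refine fun h i j => ⟨?_, ?_⟩
    · rintro rfl
      rw [h, Fin.rev_rev]
    · rintro rfl
      rw [← h, h, h, Fin.rev_rev]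

theorem mem_quarterTurnBaxter {n : ℕ} {w : Equiv.Perm (Fin n)} :
    w ∈ quarterTurnBaxter n ↔ IsBaxter w ∧ IsQuarterTurn w :=
  and_congr_right fun _ => rotate90_permMatrix_eq_iff w

namespace IsQuarterTurn

variable {n : ℕ} {w : Equiv.Perm (Fin n)}

theorem apply_rev (hw : IsQuarterTurn w) (x : Fin n) : w x.rev = (w x).rev := by
  rw [← hw x, hw (w x)]

theorem apply_rev_apply (hw : IsQuarterTurn w) (x : Fin n) : w (w x).rev = x := by
  rw [hw.apply_rev, hw, Fin.rev_rev]

end IsQuarterTurn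

/-- The permutation whose matrix is the mirror image of that of `w`. Mirroring exchanges the two
forbidden patterns and preserves quarter-turn symmetry. -/
def mirror {n : ℕ} (w : Equiv.Perm (Fin n)) : Equiv.Perm (Fin n) :=
  w.trans Fin.revPerm

section Mirror

variable {n : ℕ} {w : Equiv.Perm (Fin n)}

@[simp]
theorem mirror_apply (x : Fin n) : mirror w x = (w x).rev := rfl

@[simp]
theorem mirror_mirror : mirror (mirror w) = w := by
  ext x
  simp

protected theorem IsQuarterTurn.mirror (hw : IsQuarterTurn w) : IsQuarterTurn (mirror w) := by
  intro x
  rw [mirror_apply, mirror_apply, hw.apply_rev, hw, Fin.rev_rev]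

theorem contains2413_iff_contains3142_mirror : Contains2413 w ↔ Contains3142 (mirror w) := by
  simp only [Contains2413, Contains3142, mirror_apply, Fin.rev_lt_rev]
  refine exists₄_congr fun i j j' k => ?_
  tauto

theorem isBaxter_iff : IsBaxter w ↔ ¬ Contains3142 w ∧ ¬ Contains3142 (mirror w) := by
  rw [IsBaxter, contains2413_iff_contains3142_mirror]

theorem isBaxter_mirror : IsBaxter (mirror w) ↔ IsBaxter w := by
  rw [isBaxter_iff, isBaxter_iff, mirror_mirror, and_comm]

theorem mirror_mem_quarterTurnBaxter (hw : w ∈ quarterTurnBaxter n) :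
    mirror w ∈ quarterTurnBaxter n := by
  rw [mem_quarterTurnBaxter] at hw ⊢
  exact ⟨isBaxter_mirror.2 hw.1, hw.2.mirror⟩

end Mirror

/-- The positions of the left-to-right maxima of `w`; their number is the label of `w` in the
generating tree. -/
def leftMaxima {n : ℕ} (w : Equiv.Perm (Fin n)) : Finset (Fin n) :=
  Finset.univ.filter fun q => ∀ i < q, w i < w q

section LeftMaxima

variable {n : ℕ} {w : Equiv.Perm (Fin n)}

theorem mem_leftMaxima {q : Fin n} : q ∈ leftMaxima w ↔ ∀ i < q, w i < w q := by
  simp [leftMaxima]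

theorem mem_leftMaxima_iff_forall_le {q : Fin n} :
    q ∈ leftMaxima w ↔ ∀ i ≤ q, w i ≤ w q := by
  rw [mem_leftMaxima]
  refine forall_congr' fun i => ⟨fun h hi => ?_, fun h hi => ?_⟩
  · rcases hi.eq_or_lt with rfl | hi
    exacts [le_rfl, (h hi).le]
  · exact (h hi.le).lt_of_ne (w.injective.ne hi.ne)

-- The left-to-right maxima lie above the left-to-right minima, and for a quarter-turn symmetric
-- permutation the latter are the rotated copies of the former.
theorem IsQuarterTurn.le_apply_of_mem_leftMaxima (hw : IsQuarterTurn w) {q y : Fin n}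
    (hq : q ∈ leftMaxima w) (hy : y ∈ leftMaxima w) : q ≤ w y := by
  rw [mem_leftMaxima] at hq hy
  by_contra! hlt
  have h_rev : (w q).rev < y := by simpa only [hw y, Fin.rev_lt_iff] using hq _ hlt
  have h_gt : q < w y := by simpa only [hw.apply_rev_apply] using hy _ h_rev
  exact lt_asymm h_gt hlt

theorem IsQuarterTurn.rev_apply_mem_leftMaxima_mirror_iff (hw : IsQuarterTurn w) {q : Fin n} :
    (w q).rev ∈ leftMaxima (mirror w) ↔ q ∈ leftMaxima w := by
  have h_surj : Function.Surjective fun x => (w x).rev := Fin.rev_surjective.comp w.surjective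
  rw [mem_leftMaxima, mem_leftMaxima_iff_forall_le, h_surj.forall]
  refine forall_congr' fun i => ?_
  simp only [mirror_apply, hw.apply_rev_apply, Fin.rev_lt_rev]
  rw [← not_imp_not, not_lt, not_lt]

theorem IsQuarterTurn.card_leftMaxima_mirror (hw : IsQuarterTurn w) :
    (leftMaxima (mirror w)).card = (leftMaxima w).card := by
  symm
  refine Finset.card_bij (fun q _ => (w q).rev)
    (fun q => hw.rev_apply_mem_leftMaxima_mirror_iff.2)
    (fun a _ b _ hab => w.injective (Fin.rev_injective hab)) fun b hb => ?_
  have h_eq : (w (w b)).rev = b := by rw [hw, Fin.rev_rev]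
  exact ⟨w b, hw.rev_apply_mem_leftMaxima_mirror_iff.1 (by rwa [h_eq]), h_eq⟩

end LeftMaxima

/-- An occurrence of the pattern 3142 at positions `i < a < b < k` such that `f` has no point
strictly between the columns `a` and `b` and strictly between the rows `f k` and `f i`. This
replaces the adjacency of `a` and `b` in 3-14-2 by a condition that is invariant under quarter
turns. -/
structure IsMesh3142 {α β : Type*} [LinearOrder α] [LinearOrder β] (f : α → β) (i a b k : α) :
    Prop where
  fst_lt_snd : i < a
  snd_lt_trd : a < b
  trd_lt_fth : b < k
  apply_snd_lt : f a < f k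
  apply_fth_lt : f k < f i
  apply_fst_lt : f i < f b
  box_empty : ∀ c, a < c → c < b → f c ≤ f k ∨ f i ≤ f c

section Mesh

variable {α β : Type*} [LinearOrder α] [LinearOrder β] {f : α → β} {i a b k s : α}

theorem IsMesh3142.replace_right (h : IsMesh3142 f i a b k) (hbs : b ⋖ s)
    (hs : ∀ x < b, f x < f s) : IsMesh3142 f i a s k := by
  have his : f i < f s := hs i (h.fst_lt_snd.trans h.snd_lt_trd)
  have hsk : s ≠ k := by
    rintro rfl
    exact lt_asymm h.apply_fth_lt his
  refine ⟨h.fst_lt_snd, h.snd_lt_trd.trans hbs.lt, (hbs.ge_of_gt h.trd_lt_fth).lt_of_ne hsk,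
    h.apply_snd_lt, h.apply_fth_lt, his, fun c hac hcs => ?_⟩
  rcases (hbs.le_of_lt hcs).eq_or_lt with rfl | hcb
  exacts [Or.inr h.apply_fst_lt.le, h.box_empty c hac hcb]

theorem IsMesh3142.replace_left (hf : f.Injective) (h : IsMesh3142 f i a b k) (hsb : s ⋖ b)
    (hs : ∀ x > b, f x < f s) : IsMesh3142 f i a s k := by
  have hks : f k < f s := hs k h.trd_lt_fth
  have has : a < s := by
    refine (hsb.le_of_lt h.snd_lt_trd).lt_of_ne ?_
    rintro rfl
    exact lt_asymm h.apply_snd_lt hks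
  have his : f i < f s :=
    ((h.box_empty s has hsb.lt).resolve_left hks.not_ge).lt_of_ne
      (hf.ne (h.fst_lt_snd.trans has).ne)
  exact ⟨h.fst_lt_snd, has, hsb.lt.trans h.trd_lt_fth, h.apply_snd_lt, h.apply_fth_lt, his,
    fun c hac hcs => h.box_empty c hac (hcs.trans hsb.lt)⟩

end Mesh

theorem contains3142_iff_exists_isMesh3142 {n : ℕ} {w : Equiv.Perm (Fin n)} :
    Contains3142 w ↔ ∃ i a b k, IsMesh3142 w i a b k := by
  constructor
  · rintro ⟨i, a, b, k, hia, hab, hbk, h_ak, h_ki, h_ib⟩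
    exact ⟨i, a, b, k, hia, by lia, hbk, h_ak, h_ki, h_ib, by lia⟩
  · rintro ⟨i, a, b, k, h⟩
    obtain ⟨j', hj', h_min⟩ := WellFounded.has_min wellFounded_lt {c | a < c ∧ w i < w c}
      ⟨b, h.snd_lt_trd, h.apply_fst_lt⟩
    obtain ⟨j, haj, hjj'⟩ := exists_le_covBy_of_lt hj'.1
    have hj'b : j' ≤ b := not_lt.1 (h_min b ⟨h.snd_lt_trd, h.apply_fst_lt⟩)
    have hjb : j < b := hjj'.lt.trans_le hj'b
    have h_jk : w j < w k := by
      rcases haj.eq_or_lt with rfl | haj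
      · exact h.apply_snd_lt
      · have hji : w j ≤ w i := not_lt.1 fun hij => h_min j ⟨haj, hij⟩ hjj'.lt
        refine ((h.box_empty j haj hjb).resolve_right fun hij => ?_).lt_of_ne
          (w.injective.ne (hjb.trans h.trd_lt_fth).ne)
        exact (h.fst_lt_snd.trans haj).ne (w.injective (hij.antisymm hji))
    exact ⟨i, j, j', k, h.fst_lt_snd.trans_le haj, (Nat.covBy_iff_add_one_eq.1 hjj'.coe_fin).symm,
      hj'b.trans_lt h.trd_lt_fth, h_jk, h.apply_fth_lt, hj'.2⟩

theorem IsMesh3142.rotate {n : ℕ} {w : Equiv.Perm (Fin n)} (hw : IsQuarterTurn w)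
    {i a b k : Fin n} (h : IsMesh3142 w i a b k) : IsMesh3142 w (w a) (w k) (w i) (w b) := by
  refine ⟨h.apply_snd_lt, h.apply_fth_lt, h.apply_fst_lt, ?_, ?_, ?_, ?_⟩
  · simpa only [hw _, Fin.rev_lt_rev] using h.trd_lt_fth
  · simpa only [hw _, Fin.rev_lt_rev] using h.snd_lt_trd
  · simpa only [hw _, Fin.rev_lt_rev] using h.fst_lt_snd
  · refine w.surjective.forall.2 fun x hkx hxi => ?_
    simp only [hw _, Fin.rev_le_rev]
    by_contra! hx
    exact (h.box_empty x hx.2 hx.1).elim hkx.not_ge hxi.not_ge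

/-- The quarter-turn invariant embedding `ι` of positions exhibits `v` as a subpermutation of `w`
all of whose missing points lie on the boundary of the matrix of `w`. -/
structure IsFraming {m n : ℕ} (ι : Fin m ↪o Fin n) (w : Equiv.Perm (Fin n))
    (v : Equiv.Perm (Fin m)) : Prop where
  emb_rev : ∀ y, ι y.rev = (ι y).rev
  apply_emb : ∀ y, w (ι y) = ι (v y)
  extremal : ∀ x, x ∉ Set.range ι → IsMin x ∨ IsMax x ∨ IsMin (w x) ∨ IsMax (w x)

namespace IsFraming

variable {m n : ℕ} {ι : Fin m ↪o Fin n} {w : Equiv.Perm (Fin n)} {v : Equiv.Perm (Fin m)}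

theorem isQuarterTurn (h : IsFraming ι w v) (hw : IsQuarterTurn w) : IsQuarterTurn v := fun y =>
  ι.injective (by rw [← h.apply_emb, ← h.apply_emb, hw, h.emb_rev])

protected theorem mirror (h : IsFraming ι w v) : IsFraming ι (mirror w) (mirror v) where
  emb_rev := h.emb_rev
  apply_emb y := by rw [mirror_apply, mirror_apply, h.apply_emb, h.emb_rev]
  extremal x hx := by
    have h_min : IsMin (w x).rev ↔ IsMax (w x) := Fin.revOrderIso.isMin_apply
    have h_max : IsMax (w x).rev ↔ IsMin (w x) := Fin.revOrderIso.isMax_apply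
    rw [mirror_apply, h_min, h_max]
    exact (h.extremal x hx).imp_right (Or.imp_right Or.symm)

theorem isMesh3142_emb_iff (h : IsFraming ι w v) {i a b k : Fin m} :
    IsMesh3142 w (ι i) (ι a) (ι b) (ι k) ↔ IsMesh3142 v i a b k := by
  constructor
  · rintro ⟨hia, hab, hbk, h_ak, h_ki, h_ib, h_box⟩
    simp only [h.apply_emb, OrderEmbedding.lt_iff_lt] at hia hab hbk h_ak h_ki h_ib
    refine ⟨hia, hab, hbk, h_ak, h_ki, h_ib, fun c hac hcb => ?_⟩
    simpa only [h.apply_emb, OrderEmbedding.le_iff_le] using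
      h_box (ι c) (ι.lt_iff_lt.2 hac) (ι.lt_iff_lt.2 hcb)
  · rintro ⟨hia, hab, hbk, h_ak, h_ki, h_ib, h_box⟩
    refine ⟨by simpa, by simpa, by simpa, by simpa [h.apply_emb], by simpa [h.apply_emb],
      by simpa [h.apply_emb], fun c hac hcb => ?_⟩
    by_cases hc : c ∈ Set.range ι
    · obtain ⟨c, rfl⟩ := hc
      simpa only [h.apply_emb, OrderEmbedding.le_iff_le] using
        h_box c (ι.lt_iff_lt.1 hac) (ι.lt_iff_lt.1 hcb)
    · rcases h.extremal c hc with hc | hc | hc | hc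
      · exact absurd hac hc.not_lt
      · exact absurd hcb hc.not_lt
      · exact Or.inl (hc.isBot _)
      · exact Or.inr (hc.isTop _)

theorem contains3142 (h : IsFraming ι w v) (hv : Contains3142 v) : Contains3142 w := by
  rw [contains3142_iff_exists_isMesh3142] at hv ⊢
  obtain ⟨i, a, b, k, hv⟩ := hv
  exact ⟨_, _, _, _, h.isMesh3142_emb_iff.2 hv⟩

theorem isBaxter_of_isBaxter (h : IsFraming ι w v) (hw : IsBaxter w) : IsBaxter v := by
  rw [isBaxter_iff] at hw ⊢
  exact ⟨mt h.contains3142 hw.1, mt h.mirror.contains3142 hw.2⟩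

-- In a mesh occurrence only the third point can be the highest one. Pulling it into the core and
-- rotating, four times over, moves all four points of the occurrence into the core.
theorem contains3142_of_replace (h : IsFraming ι w v) (hw : IsQuarterTurn w)
    (h_replace : ∀ i a b k, IsMesh3142 w i a b k → IsMax (w b) → ∃ y, IsMesh3142 w i a (ι y) k)
    (hc : Contains3142 w) : Contains3142 v := by
  have pull_rotate : ∀ {i a b k}, IsMesh3142 w i a b k →
      ∃ y, IsMesh3142 w (w a) (w k) (w i) (ι y) := fun {i a b k} h_mesh => by
    have h_pull : ∃ y, IsMesh3142 w i a (ι y) k := by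
      by_cases hb : b ∈ Set.range ι
      · obtain ⟨y, rfl⟩ := hb
        exact ⟨y, h_mesh⟩
      · rcases h.extremal b hb with hb | hb | hb | hb
        · exact absurd h_mesh.snd_lt_trd hb.not_lt
        · exact absurd h_mesh.trd_lt_fth hb.not_lt
        · exact absurd (h_mesh.apply_fth_lt.trans h_mesh.apply_fst_lt) hb.not_lt
        · exact h_replace i a b k h_mesh hb
    obtain ⟨y, hy⟩ := h_pull
    exact ⟨v y, h.apply_emb y ▸ hy.rotate hw⟩
  rw [contains3142_iff_exists_isMesh3142] at hc ⊢
  obtain ⟨i, a, b, k, h₀⟩ := hc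
  obtain ⟨k₁, h₁⟩ := pull_rotate h₀
  obtain ⟨k₂, h₂⟩ := pull_rotate h₁
  obtain ⟨k₃, h₃⟩ := pull_rotate h₂
  obtain ⟨k₄, h₄⟩ := pull_rotate h₃
  simp only [h.apply_emb] at h₄
  exact ⟨_, _, _, _, h.isMesh3142_emb_iff.1 h₄⟩

theorem isBaxter (h : IsFraming ι w v) (hw : IsQuarterTurn w) (hv : IsBaxter v) {p : Fin n}
    {q : Fin m} (hp : IsMax (w p)) (hpq : p ⋖ ι q) (hq : ∀ i < p, w i < w (ι q)) :
    IsBaxter w := by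
  have eq_of_isMax : ∀ {b}, IsMax (w b) → b = p := fun hb =>
    w.injective (le_antisymm (hp.isTop _) (hb.isTop _))
  rw [isBaxter_iff] at hv ⊢
  constructor
  · refine mt (h.contains3142_of_replace hw fun i a b k h_mesh hb => ?_) hv.1
    obtain rfl := eq_of_isMax hb
    exact ⟨q, h_mesh.replace_right hpq hq⟩
  · refine mt (h.mirror.contains3142_of_replace hw.mirror fun i a b k h_mesh hb => ?_) hv.2
    rw [mirror_apply, ← hw.apply_rev] at hb
    obtain rfl := eq_of_isMax hb
    have h_cov : ι q.rev ⋖ b := by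
      rw [h.emb_rev, ← b.rev_rev]
      exact (apply_covBy_apply_iff Fin.revOrderIso).2 hpq.toDual
    refine ⟨q.rev, h_mesh.replace_left (mirror w).injective h_cov fun x hx => ?_⟩
    rw [mirror_apply, mirror_apply, ← hw.apply_rev, ← hw.apply_rev, h.emb_rev, Fin.rev_rev]
    exact hq _ (Fin.rev_lt_rev.2 hx)

end IsFraming

/-- The embedding of `Fin n` into `Fin (n + 4)` that skips the first and the last position, the
position immediately before the image of `q` and the position immediately after the image of
`q.rev`. Deleting the corresponding rows and columns leaves a core of size `n`. -/
def coreEmb {n : ℕ} (q : Fin n) : Fin n ↪o Fin (n + 4) :=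
  OrderEmbedding.ofStrictMono
    (fun y => ⟨y + 1 + (if (q : ℕ) ≤ y then 1 else 0) + (if n ≤ q + y then 1 else 0),
      by split_ifs <;> lia⟩)
    (fun x y hxy => by rw [Fin.mk_lt_mk]; split_ifs <;> lia)

/-- The position, just before the image of `q`, of the largest entry after an orbit insertion
at `q`. -/
def peak {n : ℕ} (q : Fin n) : Fin (n + 4) :=
  ⟨q + 1 + if n ≤ 2 * q then 1 else 0, by split_ifs <;> lia⟩

/-- The four positions skipped by `coreEmb q`, in the order in which a quarter-turn symmetric
permutation with first entry `peak q` runs through them. -/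
def orbit {n : ℕ} (q : Fin n) : Fin 4 → Fin (n + 4) :=
  ![0, peak q, Fin.last (n + 3), (peak q).rev]

section Positions

variable {n : ℕ} {q y : Fin n}

theorem coreEmb_val (q y : Fin n) : (coreEmb q y : ℕ) =
    y + 1 + (if (q : ℕ) ≤ y then 1 else 0) + (if n ≤ q + y then 1 else 0) := rfl

theorem peak_val (q : Fin n) : (peak q : ℕ) = q + 1 + if n ≤ 2 * q then 1 else 0 := rfl

theorem coreEmb_rev (q y : Fin n) : coreEmb q y.rev = (coreEmb q y).rev := by
  simp only [Fin.ext_iff, coreEmb_val, Fin.val_rev]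
  split_ifs <;> lia

theorem peak_covBy_coreEmb (q : Fin n) : peak q ⋖ coreEmb q q := by
  rw [Fin.covBy_iff, Nat.covBy_iff_add_one_eq, coreEmb_val, peak_val, ← two_mul]
  split_ifs <;> lia

theorem peak_add_one (q : Fin n) : peak q + 1 = coreEmb q q := by
  rw [Fin.ext_iff, Fin.val_add_one_of_lt' (by rw [peak_val]; split_ifs <;> lia)]
  exact Nat.covBy_iff_add_one_eq.1 (peak_covBy_coreEmb q).coe_fin

theorem coreEmb_lt_peak_iff : coreEmb q y < peak q ↔ y < q := by
  rw [Fin.lt_def, Fin.lt_def, coreEmb_val, peak_val]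
  split_ifs <;> lia

theorem peak_injective : (peak : Fin n → Fin (n + 4)).Injective := fun a b hab => by
  rw [Fin.ext_iff, peak_val, peak_val] at hab
  ext
  split_ifs at hab <;> lia

theorem exists_eq_peak {p s : Fin (n + 4)} (hps : p ⋖ s) (h_zero : p ≠ 0) (h_rev : p ≠ p.rev)
    (h_last : s ≠ Fin.last (n + 3)) (h_succ : s ≠ p.rev) : ∃ q : Fin n, p = peak q := by
  rw [Fin.covBy_iff, Nat.covBy_iff_add_one_eq] at hps
  simp only [Ne, Fin.ext_iff, Fin.val_rev, Fin.val_last, Fin.val_zero] at h_zero h_rev h_last h_succ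
  by_cases hp : 2 * (p : ℕ) < n + 2
  · refine ⟨⟨p - 1, by lia⟩, Fin.ext ?_⟩
    rw [peak_val, if_neg (by lia)]
    lia
  · refine ⟨⟨p - 2, by lia⟩, Fin.ext ?_⟩
    rw [peak_val, if_pos (by lia)]
    lia

theorem orbit_add_two (q : Fin n) (k : Fin 4) : orbit q (k + 2) = (orbit q k).rev := by
  fin_cases k <;> simp [orbit]

theorem orbit_injective (q : Fin n) : (orbit q).Injective := by
  have h_zero : (0 : Fin (n + 4)).val = 0 := rfl
  have h_peak := peak_val q
  have h_last := Fin.val_last (n + 3)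
  have h_rev := Fin.val_rev (peak q)
  refine Fin.cons_injective_iff.2 ⟨?_, Fin.cons_injective_iff.2 ⟨?_, Fin.cons_injective_iff.2
    ⟨?_, Function.injective_of_subsingleton _⟩⟩⟩ <;>
  simp only [Matrix.range_cons, Matrix.range_empty, Set.union_empty, Set.singleton_union,
    Set.mem_insert_iff, Set.mem_singleton_iff, Fin.ext_iff, not_or] <;>
  split_ifs at h_peak <;> lia

theorem coreEmb_ne_orbit (q y : Fin n) (k : Fin 4) : coreEmb q y ≠ orbit q k := by
  have h_core := coreEmb_val q y
  have h_peak := peak_val q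
  have h_rev := Fin.val_rev (peak q)
  rw [Ne, Fin.ext_iff]
  fin_cases k
  · change (coreEmb q y : ℕ) ≠ 0
    split_ifs at h_core <;> lia
  · change (coreEmb q y : ℕ) ≠ peak q
    split_ifs at h_core h_peak <;> lia
  · change (coreEmb q y : ℕ) ≠ n + 3
    split_ifs at h_core <;> lia
  · change (coreEmb q y : ℕ) ≠ (peak q).rev
    split_ifs at h_core h_peak <;> lia

end Positions

/-- The positions `Fin (n + 4)`, split into the core around `q` and the orbit of the boundary
positions. -/
noncomputable def lineEquiv {n : ℕ} (q : Fin n) : Fin n ⊕ Fin 4 ≃ Fin (n + 4) :=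
  Equiv.ofBijective (Sum.elim (coreEmb q) (orbit q)) <|
    (Fintype.bijective_iff_injective_and_card _).2
      ⟨(coreEmb q).injective.sumElim (orbit_injective q) (coreEmb_ne_orbit q), by simp⟩

theorem lineEquiv_inl {n : ℕ} (q y : Fin n) : lineEquiv q (Sum.inl y) = coreEmb q y := rfl

theorem lineEquiv_inr {n : ℕ} (q : Fin n) (k : Fin 4) : lineEquiv q (Sum.inr k) = orbit q k := rfl

@[elab_as_elim]
theorem line_cases {n : ℕ} (q : Fin n) {motive : Fin (n + 4) → Prop}
    (core : ∀ y, motive (coreEmb q y)) (zero : motive 0)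
    (last : motive (Fin.last (n + 3))) (rev_peak : motive (peak q).rev) (peak : motive (peak q))
    (x : Fin (n + 4)) : motive x := by
  obtain ⟨y | k, rfl⟩ := (lineEquiv q).surjective x
  · exact core y
  · fin_cases k
    exacts [zero, peak, last, rev_peak]

/-- The permutation obtained from `v` by adding a 4-cycle of boundary points around the core. For
`v` with quarter-turn symmetry this is the symmetric way to add a first row, a last row, a first
column and a last column, with the new largest entry immediately before position `q`. -/
noncomputable def insertOrbit {n : ℕ} (q : Fin n) (v : Equiv.Perm (Fin n)) :
    Equiv.Perm (Fin (n + 4)) :=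
  (lineEquiv q).permCongr (Equiv.Perm.sumCongr v (finRotate 4))

section InsertOrbit

variable {n : ℕ} {q : Fin n} {v : Equiv.Perm (Fin n)}

@[simp]
theorem insertOrbit_coreEmb (q : Fin n) (v : Equiv.Perm (Fin n)) (y : Fin n) :
    insertOrbit q v (coreEmb q y) = coreEmb q (v y) := by
  rw [← lineEquiv_inl, insertOrbit, Equiv.permCongr_apply, Equiv.symm_apply_apply]
  rfl

theorem insertOrbit_orbit (q : Fin n) (v : Equiv.Perm (Fin n)) (k : Fin 4) :
    insertOrbit q v (orbit q k) = orbit q (k + 1) := by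
  rw [← lineEquiv_inr, insertOrbit, Equiv.permCongr_apply, Equiv.symm_apply_apply,
    ← finRotate_apply]
  rfl

@[simp]
theorem insertOrbit_zero (q : Fin n) (v : Equiv.Perm (Fin n)) : insertOrbit q v 0 = peak q :=
  insertOrbit_orbit q v 0

@[simp]
theorem insertOrbit_peak (q : Fin n) (v : Equiv.Perm (Fin n)) :
    insertOrbit q v (peak q) = Fin.last (n + 3) :=
  insertOrbit_orbit q v 1

@[simp]
theorem insertOrbit_rev_peak (q : Fin n) (v : Equiv.Perm (Fin n)) :
    insertOrbit q v (peak q).rev = 0 :=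
  insertOrbit_orbit q v 3

protected theorem IsQuarterTurn.insertOrbit (hv : IsQuarterTurn v) (q : Fin n) :
    IsQuarterTurn (insertOrbit q v) := by
  intro x
  obtain ⟨y | k, rfl⟩ := (lineEquiv q).surjective x
  · rw [lineEquiv_inl, insertOrbit_coreEmb, insertOrbit_coreEmb, hv, coreEmb_rev]
  · rw [lineEquiv_inr, insertOrbit_orbit, insertOrbit_orbit, add_assoc, ← orbit_add_two]
    rfl

theorem isFraming_insertOrbit (q : Fin n) (v : Equiv.Perm (Fin n)) :
    IsFraming (coreEmb q) (insertOrbit q v) v where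
  emb_rev := coreEmb_rev q
  apply_emb := insertOrbit_coreEmb q v
  extremal x hx := by
    induction x using line_cases q with
    | core y => exact absurd (Set.mem_range_self y) hx
    | zero => exact Or.inl isMin_bot
    | peak => exact Or.inr (Or.inr (Or.inr (insertOrbit_peak q v ▸ isMax_top)))
    | last => exact Or.inr (Or.inl isMax_top)
    | rev_peak => exact Or.inr (Or.inr (Or.inl (insertOrbit_rev_peak q v ▸ isMin_bot)))

theorem insertOrbit_injective {q' : Fin n} {v' : Equiv.Perm (Fin n)}
    (h : insertOrbit q v = insertOrbit q' v') : q = q' ∧ v = v' := by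
  have hq : q = q' := peak_injective (by rw [← insertOrbit_zero q v, h, insertOrbit_zero])
  subst hq
  refine ⟨rfl, Equiv.ext fun y => (coreEmb q).injective ?_⟩
  rw [← insertOrbit_coreEmb, h, insertOrbit_coreEmb]

end InsertOrbit

theorem IsQuarterTurn.apply_orbit {n : ℕ} {w : Equiv.Perm (Fin (n + 4))} (hw : IsQuarterTurn w)
    {q : Fin n} (hq : w 0 = peak q) (k : Fin 4) : w (orbit q k) = orbit q (k + 1) := by
  have h_peak : w (peak q) = Fin.last (n + 3) := by rw [← hq, hw, Fin.rev_zero]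
  fin_cases k
  · exact hq
  · exact h_peak
  · change w (Fin.last (n + 3)) = (peak q).rev
    rw [← Fin.rev_zero, hw.apply_rev, hq]
  · change w (peak q).rev = 0
    rw [hw.apply_rev, h_peak, Fin.rev_last]

theorem IsQuarterTurn.exists_eq_insertOrbit {n : ℕ} {w : Equiv.Perm (Fin (n + 4))}
    (hw : IsQuarterTurn w) {q : Fin n} (hq : w 0 = peak q) : ∃ v, w = insertOrbit q v := by
  set σ := (lineEquiv q).symm.permCongr w with hσ
  have h_inr (k : Fin 4) : σ (Sum.inr k) = Sum.inr (finRotate 4 k) := by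
    rw [hσ, Equiv.permCongr_apply, Equiv.symm_symm, Equiv.symm_apply_eq, finRotate_apply]
    exact hw.apply_orbit hq k
  have h_inl : Set.MapsTo σ (Set.range Sum.inl) (Set.range Sum.inl) := by
    rintro _ ⟨y, rfl⟩
    rcases h_eq : σ (Sum.inl y) with z | k
    · exact Set.mem_range_self z
    · have h_pre := h_inr ((finRotate 4).symm k)
      rw [Equiv.apply_symm_apply, ← h_eq, σ.apply_eq_iff_eq] at h_pre
      cases h_pre
  obtain ⟨⟨v, τ⟩, (h_sum : Equiv.Perm.sumCongr v τ = σ)⟩ :=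
    Equiv.Perm.mem_sumCongrHom_range_of_perm_mapsTo_inl h_inl
  have hτ : τ = finRotate 4 := Equiv.ext fun k => by
    simpa [← h_sum] using h_inr k
  refine ⟨v, ?_⟩
  rw [insertOrbit, ← hτ, h_sum]
  ext x
  simp [σ]

section LeftMaxima

variable {n : ℕ} {v : Equiv.Perm (Fin n)} {q y : Fin n}

theorem insertOrbit_lt_of_mem_leftMaxima (hv : IsQuarterTurn v) (hq : q ∈ leftMaxima v)
    (hy : y ∈ leftMaxima v) {i : Fin (n + 4)} (hi : i < coreEmb q y) (hi_peak : i < peak q) :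
    insertOrbit q v i < insertOrbit q v (coreEmb q y) := by
  rw [insertOrbit_coreEmb]
  induction i using line_cases q with
  | core i =>
    rw [insertOrbit_coreEmb, (coreEmb q).lt_iff_lt]
    exact mem_leftMaxima.1 hy i ((coreEmb q).lt_iff_lt.1 hi)
  | zero =>
    rw [insertOrbit_zero]
    exact (peak_covBy_coreEmb q).lt.trans_le
      ((coreEmb q).le_iff_le.2 (hv.le_apply_of_mem_leftMaxima hq hy))
  | last => exact absurd hi (Fin.le_last _).not_gt
  | rev_peak =>
    rw [insertOrbit_rev_peak]
    exact Fin.pos_of_ne_zero (coreEmb_ne_orbit q (v y) 0)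
  | peak => exact absurd hi_peak (lt_irrefl _)

theorem forall_lt_peak_iff_mem_leftMaxima (hv : IsQuarterTurn v) :
    (∀ i < peak q, insertOrbit q v i < insertOrbit q v (coreEmb q q)) ↔ q ∈ leftMaxima v := by
  refine ⟨fun h => mem_leftMaxima.2 fun y hy => ?_, fun hq i hi => ?_⟩
  · simpa using h (coreEmb q y) (coreEmb_lt_peak_iff.2 hy)
  · exact insertOrbit_lt_of_mem_leftMaxima hv hq hq (hi.trans (peak_covBy_coreEmb q).lt) hi

theorem coreEmb_mem_leftMaxima_insertOrbit (hv : IsQuarterTurn v) (hq : q ∈ leftMaxima v) :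
    coreEmb q y ∈ leftMaxima (insertOrbit q v) ↔ y ∈ leftMaxima v ∧ y < q := by
  rw [mem_leftMaxima (w := insertOrbit q v)]
  constructor
  · intro h
    refine ⟨mem_leftMaxima.2 fun i hi => by simpa using h (coreEmb q i) (by simpa), ?_⟩
    by_contra! hqy
    have h_peak := h (peak q) ((peak_covBy_coreEmb q).lt.trans_le ((coreEmb q).le_iff_le.2 hqy))
    rw [insertOrbit_peak] at h_peak
    exact h_peak.not_ge (Fin.le_last _)
  · rintro ⟨hy, hyq⟩ i hi
    exact insertOrbit_lt_of_mem_leftMaxima hv hq hy hi (hi.trans (coreEmb_lt_peak_iff.2 hyq))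

theorem orbit_mem_leftMaxima_insertOrbit (q : Fin n) (v : Equiv.Perm (Fin n)) {k : Fin 4} :
    orbit q k ∈ leftMaxima (insertOrbit q v) ↔ k ∈ ({0, 1} : Finset (Fin 4)) := by
  rw [mem_leftMaxima, insertOrbit_orbit]
  fin_cases k
  · exact iff_of_true (fun i hi => absurd hi (Fin.not_lt_zero i)) (by decide)
  · refine iff_of_true (fun i hi => Fin.lt_last_iff_ne_last.2 ?_) (by decide)
    exact insertOrbit_peak q v ▸ (insertOrbit q v).injective.ne hi.ne
  · have h_lt : peak q < Fin.last (n + 3) :=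
      Fin.lt_last_iff_ne_last.2 ((orbit_injective q).ne (by decide : (1 : Fin 4) ≠ 2))
    refine iff_of_false (fun h => ?_) (by decide)
    exact (insertOrbit_peak q v ▸ h (peak q) h_lt).not_ge (Fin.le_last _)
  · have h_pos : 0 < (peak q).rev :=
      Fin.pos_of_ne_zero ((orbit_injective q).ne (by decide : (3 : Fin 4) ≠ 0))
    exact iff_of_false (fun h => Fin.not_lt_zero _ (h 0 h_pos)) (by decide)

theorem leftMaxima_insertOrbit (hv : IsQuarterTurn v) (hq : q ∈ leftMaxima v) :
    leftMaxima (insertOrbit q v) =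
      (((leftMaxima v).filter (· < q)).disjSum {0, 1}).map (lineEquiv q).toEmbedding := by
  ext x
  obtain ⟨y | k, rfl⟩ := (lineEquiv q).surjective x
  · rw [Finset.mem_map_equiv, Equiv.symm_apply_apply, lineEquiv_inl, Finset.inl_mem_disjSum,
      Finset.mem_filter, coreEmb_mem_leftMaxima_insertOrbit hv hq]
  · rw [Finset.mem_map_equiv, Equiv.symm_apply_apply, lineEquiv_inr, Finset.inr_mem_disjSum,
      orbit_mem_leftMaxima_insertOrbit]

theorem card_leftMaxima_insertOrbit (hv : IsQuarterTurn v) (hq : q ∈ leftMaxima v) :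
    (leftMaxima (insertOrbit q v)).card = ((leftMaxima v).filter (· < q)).card + 2 := by
  rw [leftMaxima_insertOrbit hv hq, Finset.card_map, Finset.card_disjSum]
  rfl

end LeftMaxima

section PeakNeighbours

variable {n : ℕ} {w : Equiv.Perm (Fin (n + 4))}

theorem IsQuarterTurn.apply_apply_zero (hw : IsQuarterTurn w) : w (w 0) = Fin.last (n + 3) := by
  rw [hw, Fin.rev_zero]

theorem IsQuarterTurn.apply_zero_pos (hw : IsQuarterTurn w) : 0 < w 0 :=
  Fin.pos_of_ne_zero fun h => by
    have h_apply := hw.apply_apply_zero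
    rw [h, h] at h_apply
    exact Fin.last_pos.ne h_apply

theorem IsQuarterTurn.apply_zero_lt_last (hw : IsQuarterTurn w) : w 0 < Fin.last (n + 3) :=
  Fin.lt_last_iff_ne_last.2 fun h => by
    have h_apply := hw.apply_apply_zero
    rw [← h, w.apply_eq_iff_eq] at h_apply
    exact hw.apply_zero_pos.ne' h_apply

theorem IsQuarterTurn.apply_zero_covBy (hw : IsQuarterTurn w) : w 0 ⋖ w 0 + 1 := by
  rw [Fin.covBy_iff, Nat.covBy_iff_add_one_eq, Fin.val_add_one_of_lt hw.apply_zero_lt_last]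

/-- The largest entry of `w`, which sits at position `w 0` if `w` has quarter-turn symmetry, has
the larger of its two neighbours to its right. Positions wrap around, but the largest entry of a
quarter-turn symmetric permutation of length at least 4 is neither first nor last. -/
def IsRightHeavy (w : Equiv.Perm (Fin (n + 4))) : Prop :=
  w (w 0 - 1) < w (w 0 + 1)

theorem isRightHeavy_mirror_iff (hw : IsQuarterTurn w) :
    IsRightHeavy (mirror w) ↔ ¬ IsRightHeavy w := by
  have h_pred := Fin.val_sub_one_of_ne_zero hw.apply_zero_pos.ne'
  have h_succ := Nat.covBy_iff_add_one_eq.1 hw.apply_zero_covBy.coe_fin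
  have h_ne : w (w 0 + 1) ≠ w (w 0 - 1) := w.injective.ne (by lia)
  have h_add : (w 0).rev + 1 = (w 0 - 1).rev := (Fin.rev_sub _ _).symm
  have h_sub : (w 0).rev - 1 = (w 0 + 1).rev := (Fin.rev_add _ _).symm
  simp only [IsRightHeavy, mirror_apply, h_add, h_sub, hw.apply_rev, Fin.rev_rev, not_lt]
  exact ⟨le_of_lt, fun h => h.lt_of_ne h_ne⟩

-- Otherwise the entry at `i` together with the largest entry and its two neighbours would form a
-- 3-14-2.
theorem IsRightHeavy.apply_lt (h : IsRightHeavy w) (hw : IsQuarterTurn w)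
    (hc : ¬ Contains3142 w) {i : Fin (n + 4)} (hi : i < w 0) : w i < w (w 0 + 1) := by
  have h_pred := Fin.val_sub_one_of_ne_zero hw.apply_zero_pos.ne'
  have h_succ := hw.apply_zero_covBy.lt
  by_contra! h_le
  have hi_pred : i ≠ w 0 - 1 := by
    rintro rfl
    exact h_le.not_gt h
  refine hc ⟨i, w 0 - 1, w 0, w 0 + 1, by lia, by lia, h_succ, h,
    h_le.lt_of_ne (w.injective.ne (hi.trans h_succ).ne'), ?_⟩
  rw [hw.apply_apply_zero, Fin.lt_last_iff_ne_last, ← hw.apply_apply_zero]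
  exact w.injective.ne hi.ne

theorem IsQuarterTurn.exists_apply_zero_eq_peak (hw : IsQuarterTurn w)
    (h : w 0 < w (w 0 + 1)) : ∃ q : Fin n, w 0 = peak q := by
  refine exists_eq_peak hw.apply_zero_covBy hw.apply_zero_pos.ne' (fun h_rev => ?_)
    (fun h_last => ?_) (fun h_succ => ?_)
  · have h_apply := hw.apply_rev_apply 0
    rw [← h_rev, hw.apply_apply_zero] at h_apply
    exact Fin.last_pos.ne' h_apply
  · have h_val := Nat.covBy_iff_add_one_eq.1 hw.apply_zero_covBy.coe_fin
    rw [h_last, ← Fin.rev_zero, hw.apply_rev, Fin.lt_def, Fin.val_rev] at h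
    rw [h_last, Fin.val_last] at h_val
    lia
  · rw [h_succ, hw.apply_rev_apply] at h
    exact Fin.not_lt_zero _ h

end PeakNeighbours

section Growth

variable {n : ℕ} {v : Equiv.Perm (Fin n)} {q : Fin n}

theorem insertOrbit_mem_quarterTurnBaxter (hv : v ∈ quarterTurnBaxter n) (hq : q ∈ leftMaxima v) :
    insertOrbit q v ∈ quarterTurnBaxter (n + 4) := by
  rw [mem_quarterTurnBaxter] at hv ⊢
  have h_turn := hv.2.insertOrbit q
  refine ⟨(isFraming_insertOrbit q v).isBaxter h_turn hv.1 ?_ (peak_covBy_coreEmb q)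
    ((forall_lt_peak_iff_mem_leftMaxima hv.2).2 hq), h_turn⟩
  exact insertOrbit_peak q v ▸ isMax_top

theorem isRightHeavy_insertOrbit (hv : IsQuarterTurn v) (hq : q ∈ leftMaxima v) :
    IsRightHeavy (insertOrbit q v) := by
  have h_pos := (hv.insertOrbit q).apply_zero_pos
  rw [insertOrbit_zero] at h_pos
  have h_pred := Fin.val_sub_one_of_ne_zero h_pos.ne'
  rw [IsRightHeavy, insertOrbit_zero, peak_add_one]
  exact (forall_lt_peak_iff_mem_leftMaxima hv).2 hq _ (by lia)

theorem exists_eq_insertOrbit_of_isRightHeavy {w : Equiv.Perm (Fin (n + 4))}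
    (hw : w ∈ quarterTurnBaxter (n + 4)) (h : IsRightHeavy w) :
    ∃ v ∈ quarterTurnBaxter n, ∃ q ∈ leftMaxima v, insertOrbit q v = w := by
  rw [mem_quarterTurnBaxter] at hw
  obtain ⟨h_baxter, h_turn⟩ := hw
  have h_lt {i} : i < w 0 → w i < w (w 0 + 1) := h.apply_lt h_turn h_baxter.1
  obtain ⟨q, hq⟩ := h_turn.exists_apply_zero_eq_peak (h_lt h_turn.apply_zero_pos)
  obtain ⟨v, rfl⟩ := h_turn.exists_eq_insertOrbit hq
  have h_frame := isFraming_insertOrbit q v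
  have hv := h_frame.isQuarterTurn h_turn
  refine ⟨v, mem_quarterTurnBaxter.2 ⟨h_frame.isBaxter_of_isBaxter h_baxter, hv⟩, q, ?_, rfl⟩
  rw [hq, peak_add_one] at h_lt
  exact (forall_lt_peak_iff_mem_leftMaxima hv).1 fun i => h_lt

end Growth

/-- `quarterTurnBaxter n` as a finite set, over which sums are taken. -/
noncomputable def quarterTurnBaxterFinset (n : ℕ) : Finset (Equiv.Perm (Fin n)) :=
  (quarterTurnBaxter n).toFinite.toFinset

theorem mem_quarterTurnBaxterFinset {n : ℕ} {w : Equiv.Perm (Fin n)} :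
    w ∈ quarterTurnBaxterFinset n ↔ w ∈ quarterTurnBaxter n :=
  Set.Finite.mem_toFinset _

theorem ncard_quarterTurnBaxter (n : ℕ) :
    (quarterTurnBaxter n).ncard = (quarterTurnBaxterFinset n).card :=
  Set.ncard_eq_toFinset_card _ _

open Classical in
theorem sum_filter_isRightHeavy {M : Type*} [AddCommMonoid M] (n : ℕ) (g : ℕ → M) :
    ∑ w ∈ (quarterTurnBaxterFinset (n + 4)).filter IsRightHeavy, g (leftMaxima w).card =
      ∑ v ∈ quarterTurnBaxterFinset n, ∑ l ∈ Finset.range (leftMaxima v).card, g (l + 2) := by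
  simp only [← sum_card_filter_lt _ fun l => g (l + 2), Finset.sum_sigma']
  symm
  refine Finset.sum_nbij (fun x => insertOrbit x.2 x.1) ?_ ?_ ?_ ?_
  · rintro ⟨v, q⟩ h
    simp only [Finset.mem_sigma, Finset.mem_filter, mem_quarterTurnBaxterFinset] at h ⊢
    exact ⟨insertOrbit_mem_quarterTurnBaxter h.1 h.2,
      isRightHeavy_insertOrbit (mem_quarterTurnBaxter.1 h.1).2 h.2⟩
  · rintro ⟨v, q⟩ - ⟨v', q'⟩ - h
    obtain ⟨rfl, rfl⟩ := insertOrbit_injective h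
    rfl
  · intro w hw
    simp only [Finset.coe_filter, mem_quarterTurnBaxterFinset] at hw
    obtain ⟨v, hv, q, hq, rfl⟩ := exists_eq_insertOrbit_of_isRightHeavy hw.1 hw.2
    exact ⟨⟨v, q⟩, by simpa [mem_quarterTurnBaxterFinset] using ⟨hv, hq⟩, rfl⟩
  · rintro ⟨v, q⟩ h
    simp only [Finset.mem_sigma, mem_quarterTurnBaxterFinset] at h
    rw [card_leftMaxima_insertOrbit (mem_quarterTurnBaxter.1 h.1).2 h.2]

theorem sum_quarterTurnBaxterFinset_add_four {M : Type*} [AddCommMonoid M] (n : ℕ) (g : ℕ → M) :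
    ∑ w ∈ quarterTurnBaxterFinset (n + 4), g (leftMaxima w).card =
      2 • ∑ v ∈ quarterTurnBaxterFinset n, ∑ l ∈ Finset.range (leftMaxima v).card, g (l + 2) := by
  classical
  rw [← Finset.sum_filter_add_sum_filter_not _ IsRightHeavy, two_nsmul,
    ← sum_filter_isRightHeavy]
  congr 1
  have h_mirror {w : Equiv.Perm (Fin (n + 4))} (hw : w ∈ quarterTurnBaxterFinset (n + 4)) :
      mirror w ∈ quarterTurnBaxterFinset (n + 4) ∧
        (IsRightHeavy (mirror w) ↔ ¬ IsRightHeavy w) ∧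
        (leftMaxima (mirror w)).card = (leftMaxima w).card := by
    rw [mem_quarterTurnBaxterFinset] at hw ⊢
    have h_turn := (mem_quarterTurnBaxter.1 hw).2
    exact ⟨mirror_mem_quarterTurnBaxter hw, isRightHeavy_mirror_iff h_turn,
      h_turn.card_leftMaxima_mirror⟩
  refine Finset.sum_nbij' mirror mirror ?_ ?_ (fun _ _ => mirror_mirror) (fun _ _ => mirror_mirror)
    ?_
  · intro w hw
    rw [Finset.mem_filter] at hw ⊢
    exact ⟨(h_mirror hw.1).1, (h_mirror hw.1).2.1.2 hw.2⟩
  · intro w hw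
    rw [Finset.mem_filter] at hw ⊢
    exact ⟨(h_mirror hw.1).1, fun h => (h_mirror hw.1).2.1.1 h hw.2⟩
  · intro w hw
    rw [(h_mirror (Finset.mem_filter.1 hw).1).2.2]

theorem sum_treeCount_quarterTurnBaxterFinset (r m d : ℕ) :
    ∑ w ∈ quarterTurnBaxterFinset (r + 4 * m), treeCount d (leftMaxima w).card =
      2 ^ m * ∑ v ∈ quarterTurnBaxterFinset r, treeCount (m + d) (leftMaxima v).card := by
  induction m generalizing d with
  | zero => simp
  | succ m ih =>
    rw [mul_add_one, ← add_assoc, sum_quarterTurnBaxterFinset_add_four, add_right_comm m 1 d,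
      pow_succ', mul_assoc, add_assoc m d 1, ← ih (d + 1), smul_eq_mul]
    rfl

theorem ncard_quarterTurnBaxter_add_four_mul (r m : ℕ) :
    (quarterTurnBaxter (r + 4 * m)).ncard =
      2 ^ m * ∑ v ∈ quarterTurnBaxterFinset r, treeCount m (leftMaxima v).card := by
  rw [ncard_quarterTurnBaxter, Finset.card_eq_sum_ones]
  exact sum_treeCount_quarterTurnBaxterFinset r m 0

theorem ncard_quarterTurnBaxter_one_add_four_mul (m : ℕ) :
    (quarterTurnBaxter (1 + 4 * m)).ncard = 2 ^ m * catalan m := by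
  have h_mem : (1 : Equiv.Perm (Fin 1)) ∈ quarterTurnBaxter 1 := by
    rw [mem_quarterTurnBaxter, IsBaxter, Contains3142, Contains2413, IsQuarterTurn]
    decide
  have h_singleton : quarterTurnBaxterFinset 1 = {1} :=
    Finset.eq_singleton_iff_unique_mem.2
      ⟨mem_quarterTurnBaxterFinset.2 h_mem, fun _ _ => Subsingleton.elim _ _⟩
  have h_card : (leftMaxima (1 : Equiv.Perm (Fin 1))).card = 1 := by
    decide
  rw [ncard_quarterTurnBaxter_add_four_mul, h_singleton, Finset.sum_singleton, h_card,
    treeCount_one]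

theorem ncard_quarterTurnBaxter_four_mul_add_one (m : ℕ) :
    (quarterTurnBaxter (4 * (m + 1))).ncard = 0 := by
  have h_card (v : Equiv.Perm (Fin 0)) : (leftMaxima v).card = 0 :=
    Finset.card_eq_zero.2 (Finset.eq_empty_of_isEmpty _)
  rw [← zero_add (4 * (m + 1)), ncard_quarterTurnBaxter_add_four_mul]
  simp only [h_card, treeCount, Finset.range_zero, Finset.sum_empty, Finset.sum_const_zero,
    mul_zero]

theorem ncard_quarterTurnBaxter_add_four_mul_of_forall_not_isQuarterTurn {r : ℕ}
    (hr : ∀ w : Equiv.Perm (Fin r), ¬ IsQuarterTurn w) (m : ℕ) :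
    (quarterTurnBaxter (r + 4 * m)).ncard = 0 := by
  rw [ncard_quarterTurnBaxter_add_four_mul, Finset.eq_empty_of_forall_notMem fun w hw =>
    hr w (mem_quarterTurnBaxter.1 (mem_quarterTurnBaxterFinset.1 hw)).2, Finset.sum_empty, mul_zero]

theorem not_isQuarterTurn_two : ∀ w : Equiv.Perm (Fin 2), ¬ IsQuarterTurn w := by
  unfold IsQuarterTurn
  decide

theorem not_isQuarterTurn_three : ∀ w : Equiv.Perm (Fin 3), ¬ IsQuarterTurn w := by
  unfold IsQuarterTurn
  decide

theorem theorem1 (n : ℕ) (hn : 1 ≤ n) :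
    (∀ m : ℕ, n = 4 * m + 1 → (quarterTurnBaxter n).ncard = 2 ^ m * catalan m) ∧
    ((¬ ∃ m : ℕ, n = 4 * m + 1) → (quarterTurnBaxter n).ncard = 0) := by
  constructor
  · rintro m rfl
    rw [add_comm, ncard_quarterTurnBaxter_one_add_four_mul]
  · intro h_ne
    obtain ⟨r, hr, m, rfl⟩ : ∃ r < 4, ∃ m, n = r + 4 * m :=
      ⟨n % 4, Nat.mod_lt _ (by norm_num), n / 4, (Nat.mod_add_div n 4).symm⟩
    interval_cases r
    · obtain ⟨k, rfl⟩ := Nat.exists_eq_add_one_of_ne_zero (n := m) (by lia)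
      rw [zero_add, ncard_quarterTurnBaxter_four_mul_add_one]
    · exact absurd ⟨m, add_comm _ _⟩ h_ne
    · exact ncard_quarterTurnBaxter_add_four_mul_of_forall_not_isQuarterTurn not_isQuarterTurn_two m
    · exact ncard_quarterTurnBaxter_add_four_mul_of_forall_not_isQuarterTurn
        not_isQuarterTurn_three m
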